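/- Let $N\ge 1$, let $\mu$ be Lebesgue measure on $\mathbb{R}^N$, let $\mathbb{K}$ be $\mathbb{R}$ or $\mathbb{C}$, and let $L^2(\mathbb{R}^N)$ be the space of (classes of) square-integrable $\mathbb{K}$-valued functions on $\mathbb{R}^N$. For $x\in L^2(\mathbb{R}^N)$, let $\widehat{x}\in L^2(\mathbb{R}^N;\mathbb{C})$ be its Fourier(-Plancherel) transform, given by the unitary extension to $L^2(\mathbb{R}^N;\mathbb{C})$ of $\widehat{x}(\xi)=\int_{\mathbb{R}^N} x(t)e^{-2\pi i\langle t,\xi\rangle}\,dt$. Let $A$ and $B$ be Lebesgue measurable subsets of $\mathbb{R}^N$ of finite measure, and let $m\geq 3$ be an integer. Let $v_1,\dots,v_{m-2}$ be functions in $L^2(\mathbb{R}^N)$ with supports $C_1,\dots,C_{m-2}$, where the support of $v_i$ is the set $C_i=\{t : v_i(t)\neq 0\}$, determined up to a $\mu$-null set. Suppose that these supports are pairwise disjoint (up to null sets) and that, for every $i\in\{1,\dots,m-2\}$, $$\mu(C_i)<+\infty\quad\text{and}\quad \mu(C_i\setminus A)>0.$$ Then, for all functions $v_{m-1}$ and $v_m$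 in $L^2(\mathbb{R}^N)$ and all $(\eta_i)_{1\le i\le m-2}\in\mathbb{K}^{m-2}$, there exists $x\in L^2(\mathbb{R}^N)$ such that $$\int_{C_i}x(t)\overline{v_i(t)}\,dt=\eta_i\quad\text{for every } i\in\{1,\dots,m-2\},$$ $$x=v_{m-1}\ \ \mu\text{-a.e. on } A,\qquad\text{and}\qquad \widehat{x}=\widehat{v_m}\ \ \mu\text{-a.e. on } B.$$ -/

import Mathlib

open MeasureTheory
open scoped FourierTransform ComplexConjugate

/-- The Fourier-Plancherel transform `x̂ ∈ L²(ℝᴺ; ℂ)` of a real- or complex-valued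
`x ∈ L²(ℝᴺ)`: the values of `x` are regarded as complex numbers (`RCLike.map 𝕜 ℂ` is the inclusion
`ℝ ⊆ ℂ` or the identity of `ℂ`) and Mathlib's unitary Fourier transform on `L²` is applied. -/
noncomputable def fourierL2 {𝕜 : Type*} [RCLike 𝕜] {N : ℕ}
    (x : Lp 𝕜 2 (volume : Measure (EuclideanSpace ℝ (Fin N)))) :
    Lp ℂ 2 (volume : Measure (EuclideanSpace ℝ (Fin N))) :=
  𝓕 ((RCLike.map 𝕜 ℂ).compLp x)

/-! The moment conditions see `x` only on the supports `C i`. They hold, together with the condition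
on `A`, once `x` agrees on `A ∪ ⋃ C i`, a set of finite measure, with a suitable `w`: `vA` on `A`
and `∑ c i * v i` off `A`, where the `c i` can be solved for because `C i \ A` is not null
(`exists_eq_on_and_integral_mul_conj_eq`).

It remains to prescribe `x` on a set of finite measure and its transform on `B`. Let `M` be the
functions supported in the first set and `N` those with spectrum in `B`. The product `P_M P_N` is
Hilbert–Schmidt, hence compact, and `M ∩ N = 0`, so `1 - P_M P_N` is invertible by the Fredholm
alternative (`exists_mem_orthogonal_sub_mem_orthogonal`).

That `M ∩ N = 0` (`supportedL2_inf_bandLimitedL2_eq_bot`) is a dimension count: the Hilbert–Schmidt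
bound limits `dim (M ∩ N)` by the product of the two measures, while translates of a single nonzero
element would give arbitrarily many independent functions at little cost in measure. For real
scalars, the real part of a complex solution for `B ∪ -B` is taken. -/

/-! ### Hilbert–Schmidt operators and pairs of projections. -/

section HilbertSpace

variable {𝕜 H K : Type*} [RCLike 𝕜] [NormedAddCommGroup H] [InnerProductSpace 𝕜 H]
  [NormedAddCommGroup K] [InnerProductSpace 𝕜 K]

/-- Finite-dimensional truncation of an operator of Hilbert–Schmidt type. -/
theorem exists_finset_norm_apply_le_of_sum_norm_sq_le (T : H →L[𝕜] K) (c : ℝ)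
    (hT : ∀ s : Finset H, Orthonormal 𝕜 (Subtype.val : s → H) → ∑ x ∈ s, ‖T x‖ ^ 2 ≤ c)
    {ε : ℝ} (hε : 0 < ε) :
    ∃ s : Finset H, ∀ g ∈ (Submodule.span 𝕜 (s : Set H))ᗮ, ‖T g‖ ≤ ε * ‖g‖ := by
  classical
  set S : Set ℝ := {r | ∃ s : Finset H, Orthonormal 𝕜 (Subtype.val : s → H) ∧ r = ∑ x ∈ s, ‖T x‖ ^ 2}
    with hS
  have hne : S.Nonempty := ⟨0, ∅, by simp, by simp⟩
  have hbdd : BddAbove S := ⟨c, by rintro _ ⟨s, hs, rfl⟩; exact hT s hs⟩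
  -- `s` is within `ε ^ 2` of the supremum, so adjoining a unit vector `g` orthogonal to `s` forces
  -- `‖T g‖ ≤ ε`.
  obtain ⟨_, ⟨s, hs, rfl⟩, hlt⟩ :=
    exists_lt_of_lt_csSup hne (show sSup S - ε ^ 2 < sSup S by nlinarith [pow_pos hε 2])
  refine ⟨s, fun g hg => ?_⟩
  have unit : ∀ g ∈ (Submodule.span 𝕜 (s : Set H))ᗮ, ‖g‖ = 1 → ‖T g‖ ≤ ε := by
    intro g hg hg1
    have hgs : ∀ x ∈ s, inner 𝕜 x g = 0 := fun x hx =>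
      (Submodule.mem_orthogonal _ _).1 hg x (Submodule.subset_span hx)
    have hgn : g ∉ s := by
      intro h
      have := hgs g h
      rw [inner_self_eq_zero] at this
      simp [this] at hg1
    have hins : Orthonormal 𝕜 (Subtype.val : {x // x ∈ insert g s} → H) := by
      have hs' := (orthonormal_subtype_iff_ite (s := (s : Set H))).1 hs
      refine (orthonormal_subtype_iff_ite (s := ((insert g s : Finset H) : Set H))).2 ?_
      intro x hx y hy
      simp only [Finset.coe_insert, Set.mem_insert_iff, Finset.mem_coe] at hx hy
      rcases hx with rfl | hx <;> rcases hy with rfl | hy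
      · simp [inner_self_eq_norm_sq_to_K, hg1]
      · rw [if_neg (by rintro rfl; exact hgn hy), ← inner_conj_symm, hgs y hy, map_zero]
      · rw [if_neg (by rintro rfl; exact hgn hx), hgs x hx]
      · exact hs' x hx y hy
    have hle : ∑ x ∈ insert g s, ‖T x‖ ^ 2 ≤ sSup S := le_csSup hbdd ⟨_, hins, rfl⟩
    rw [Finset.sum_insert hgn] at hle
    exact le_of_sq_le_sq (by linarith) hε.le
  rcases eq_or_ne g 0 with rfl | hg0
  · simp
  · have hpos : 0 < ‖g‖ := norm_pos_iff.2 hg0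
    have h1 := unit (((‖g‖⁻¹ : ℝ) : 𝕜) • g) (Submodule.smul_mem _ _ hg) (by
      rw [norm_smul, RCLike.norm_ofReal, abs_of_pos (inv_pos.2 hpos), inv_mul_cancel₀ hpos.ne'])
    rw [map_smul, norm_smul, RCLike.norm_ofReal, abs_of_pos (inv_pos.2 hpos)] at h1
    rwa [inv_mul_le_iff₀ hpos, mul_comm] at h1

/-- An operator whose Hilbert–Schmidt sums are bounded is compact. -/
theorem isCompactOperator_of_sum_norm_sq_le [CompleteSpace K] (T : H →L[𝕜] K) (c : ℝ)
    (hT : ∀ s : Finset H, Orthonormal 𝕜 (Subtype.val : s → H) → ∑ x ∈ s, ‖T x‖ ^ 2 ≤ c) :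
    IsCompactOperator T := by
  have hcl : IsClosed {f : H →L[𝕜] K | IsCompactOperator f} :=
    isClosed_setOfPred_isCompactOperator
  refine hcl.closure_subset_iff.2 subset_rfl (Metric.mem_closure_iff.2 fun ε hε => ?_)
  obtain ⟨s, hs⟩ := exists_finset_norm_apply_le_of_sum_norm_sq_le T c hT (half_pos hε)
  set V := Submodule.span 𝕜 (s : Set H)
  have : FiniteDimensional 𝕜 V := FiniteDimensional.span_finset 𝕜 s
  have : ProperSpace V := FiniteDimensional.proper 𝕜 V
  refine ⟨T ∘L V.starProjection, ?_, ?_⟩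
  · have h : IsCompactOperator V.orthogonalProjectionOnto :=
      isCompactOperator_of_locallyCompactSpace_dom V.orthogonalProjectionOnto
    exact h.clm_comp (T ∘L V.subtypeL)
  · rw [dist_eq_norm]
    refine lt_of_le_of_lt (ContinuousLinearMap.opNorm_le_bound _ (half_pos hε).le fun f => ?_)
      (half_lt_self hε)
    have h1 := hs _ (V.sub_starProjection_mem_orthogonal f)
    have h2 : ‖f - V.starProjection f‖ ≤ ‖f‖ := by
      rw [← Submodule.starProjection_orthogonal_val]
      exact Submodule.norm_starProjection_apply_le _ f
    rw [map_sub] at h1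
    calc ‖(T - T ∘L V.starProjection) f‖ ≤ ε / 2 * ‖f - V.starProjection f‖ := h1
      _ ≤ ε / 2 * ‖f‖ := by gcongr

/-- If the product of the projections on `M` and `N` is compact and `M ⊓ N = ⊥`, then the
`M`-component of a vector orthogonal to `N` can be prescribed. -/
theorem exists_mem_orthogonal_sub_mem_orthogonal [CompleteSpace H] (M N : Submodule 𝕜 H)
    [M.HasOrthogonalProjection] [N.HasOrthogonalProjection]
    (hcomp : IsCompactOperator (M.starProjection ∘L N.starProjection)) (hMN : M ⊓ N = ⊥) (w : H) :
    ∃ x ∈ Nᗮ, x - w ∈ Mᗮ := by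
  set T := M.starProjection ∘L N.starProjection with hTdef
  have hmem : ∀ f, M.starProjection f ∈ M := fun f => M.starProjection_apply_mem f
  -- Fredholm alternative: a vector fixed by `P_M P_N` lies in `M`, and in `N` because neither
  -- projection can shorten it.
  have hres : (1 : 𝕜) ∈ resolventSet 𝕜 T := by
    refine (hcomp.hasEigenvalue_or_mem_resolventSet one_ne_zero).resolve_left fun hev => ?_
    obtain ⟨f, hf⟩ := hev.exists_hasEigenvector
    have hTf : M.starProjection (N.starProjection f) = f := by simpa [T] using hf.apply_eq_smul
    have hfM : f ∈ M := hTf ▸ hmem _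
    have hfN : f ∈ N := by
      rw [Submodule.mem_iff_norm_starProjection]
      refine le_antisymm (Submodule.norm_starProjection_apply_le _ f) ?_
      calc ‖f‖ = ‖M.starProjection (N.starProjection f)‖ := by rw [hTf]
        _ ≤ _ := Submodule.norm_starProjection_apply_le _ _
    exact hf.2 ((Submodule.mem_bot 𝕜).1 (hMN ▸ Submodule.mem_inf.2 ⟨hfM, hfN⟩))
  rw [spectrum.mem_resolventSet_iff, ContinuousLinearMap.isUnit_iff_bijective] at hres
  obtain ⟨f, hf⟩ := hres.2 (M.starProjection w)
  have hf' : f - M.starProjection (N.starProjection f) = M.starProjection w := by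
    simpa [T] using hf
  have hfM : f ∈ M := by
    rw [sub_eq_iff_eq_add.1 hf']
    exact M.add_mem (hmem _) (hmem _)
  -- As `f ∈ M`, `P_M (f - P_N f) = f - P_M P_N f = P_M w`.
  refine ⟨f - N.starProjection f, N.sub_starProjection_mem_orthogonal f, ?_⟩
  rw [← Submodule.starProjection_apply_eq_zero_iff, map_sub, map_sub,
    Submodule.starProjection_eq_self_iff.2 hfM, hf', sub_self]

end HilbertSpace

/-! ### The inverse transform as an integral. -/

section FourierInverse

variable {E : Type*} [NormedAddCommGroup E] [InnerProductSpace ℝ E] [FiniteDimensional ℝ E]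
  [MeasurableSpace E] [BorelSpace E]

theorem continuous_fourierInv_of_integrable {f : E → ℂ} (hf : Integrable f) :
    Continuous (𝓕⁻ f) :=
  VectorFourier.fourierIntegral_continuous (L := -innerₗ E) Real.continuous_fourierChar
    (continuous_inner (𝕜 := ℝ)).neg hf

/-- The inverse Fourier transform of `L²` is given by the integral on `L¹ ∩ L²`. -/
theorem fourierInv_ae_eq_of_integrable (f : Lp ℂ 2 (volume : Measure E))
    (hf : Integrable (f : E → ℂ)) :
    (𝓕⁻ f : Lp ℂ 2 (volume : Measure E)) =ᵐ[volume] 𝓕⁻ (f : E → ℂ) := by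
  -- Both sides are tested against smooth compactly supported functions; the transform is moved onto
  -- the test function, distributionally on one side and by Fubini on the other.
  refine ae_eq_of_integral_contDiff_smul_eq
    ((Lp.memLp (𝓕⁻ f : Lp ℂ 2 (volume : Measure E))).locallyIntegrable (by norm_num))
    (continuous_fourierInv_of_integrable hf).locallyIntegrable fun g hg hgc => ?_
  have hg₁ : HasCompactSupport (Complex.ofRealCLM ∘ g) := hgc.comp_left rfl
  have hg₂ : ContDiff ℝ (⊤ : ℕ∞) (Complex.ofRealCLM ∘ g) := by fun_prop
  set φ := hg₁.toSchwartzMap hg₂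
  have hφ : ∀ x, φ x = (g x : ℂ) := fun x => by simp [φ]
  have h1 := congrArg (fun T => T φ) (Lp.fourierInv_toTemperedDistribution_eq f)
  simp only [TemperedDistribution.fourierInv_apply, Lp.toTemperedDistribution_apply] at h1
  have h2 : ∫ x, (𝓕⁻ φ) x • f x = ∫ x, φ x • 𝓕⁻ (f : E → ℂ) x := by
    rw [SchwartzMap.fourierInv_coe]
    exact VectorFourier.integral_fourierIntegral_smul_eq_flip (L := -innerₗ E)
      Real.continuous_fourierChar (continuous_inner (𝕜 := ℝ)).neg φ.integrable hf |>.trans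
      (by
        congr 1 with x
        simp [VectorFourier.fourierIntegral, Real.fourierInv_eq, real_inner_comm])
  rw [h2] at h1
  simpa [hφ] using h1.symm

end FourierInverse

/-! ### Functions supported in a set, and cutoffs. -/

section L2Support

variable {α : Type*} [MeasurableSpace α] {μ : Measure α}

theorem ofReal_norm_sq_eq_lintegral (f : Lp ℂ 2 μ) :
    ENNReal.ofReal (‖f‖ ^ 2) = ∫⁻ x, ‖f x‖ₑ ^ 2 ∂μ := by
  have h := eLpNorm_nnreal_pow_eq_lintegral (f := f) (μ := μ) (p := 2) two_ne_zero
  rw [ENNReal.ofReal_pow (norm_nonneg _), ofReal_norm, Lp.enorm_def]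
  simpa using h

variable (μ) in
/-- The closed subspace of `L²` of functions vanishing almost everywhere outside `A`. -/
noncomputable def supportedL2 (A : Set α) : Submodule ℂ (Lp ℂ 2 μ) :=
  (LpToLpRestrictCLM α ℂ ℂ μ 2 Aᶜ).ker

theorem isClosed_supportedL2 (A : Set α) : IsClosed (supportedL2 μ A : Set (Lp ℂ 2 μ)) :=
  ContinuousLinearMap.isClosed_ker _

theorem mem_supportedL2_iff {A : Set α} (hA : MeasurableSet A) {f : Lp ℂ 2 μ} :
    f ∈ supportedL2 μ A ↔ ∀ᵐ x ∂μ, x ∉ A → f x = 0 := by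
  have h := LpToLpRestrictCLM_coeFn (p := 2) ℂ Aᶜ f
  rw [supportedL2, LinearMap.mem_ker, ContinuousLinearMap.coe_coe, Lp.eq_zero_iff_ae_eq_zero]
  have h1 : (LpToLpRestrictCLM α ℂ ℂ μ 2 Aᶜ f =ᵐ[μ.restrict Aᶜ] 0) ↔
      ∀ᵐ x ∂(μ.restrict Aᶜ), f x = 0 :=
    ⟨fun h0 => h.symm.trans h0, fun h0 => h.trans h0⟩
  rw [h1, ae_restrict_iff' hA.compl]
  rfl

instance (A : Set α) : (supportedL2 μ A).HasOrthogonalProjection := by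
  have : CompleteSpace (supportedL2 μ A) := (isClosed_supportedL2 A).completeSpace_coe
  infer_instance

/-- The cutoff of an `L²` function to a measurable set. -/
noncomputable def indicatorL2 {A : Set α} (hA : MeasurableSet A) (f : Lp ℂ 2 μ) : Lp ℂ 2 μ :=
  ((Lp.memLp f).indicator hA).toLp

theorem coeFn_indicatorL2 {A : Set α} (hA : MeasurableSet A) (f : Lp ℂ 2 μ) :
    indicatorL2 hA f =ᵐ[μ] A.indicator f :=
  MemLp.coeFn_toLp _

theorem indicatorL2_mem {A : Set α} (hA : MeasurableSet A) (f : Lp ℂ 2 μ) :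
    indicatorL2 hA f ∈ supportedL2 μ A := by
  rw [mem_supportedL2_iff hA]
  filter_upwards [coeFn_indicatorL2 hA f] with x hx hxA
  rw [hx, Set.indicator_of_notMem hxA]

theorem mem_orthogonal_supportedL2_iff {A : Set α} (hA : MeasurableSet A) {f : Lp ℂ 2 μ} :
    f ∈ (supportedL2 μ A)ᗮ ↔ ∀ᵐ x ∂μ, x ∈ A → f x = 0 := by
  constructor
  · intro hf
    have h := (Submodule.mem_orthogonal _ _).1 hf _ (indicatorL2_mem hA f)
    have h0 : indicatorL2 hA f = 0 := by
      rw [← inner_self_eq_zero (𝕜 := ℂ), ← h, L2.inner_def, L2.inner_def]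
      refine integral_congr_ae ?_
      filter_upwards [coeFn_indicatorL2 hA f] with x hx
      by_cases hxA : x ∈ A <;> simp [hx, hxA]
    rw [Lp.eq_zero_iff_ae_eq_zero] at h0
    filter_upwards [h0, coeFn_indicatorL2 hA f] with x h1 h2 hxA
    rw [Set.indicator_of_mem hxA] at h2
    rw [← h2, h1, Pi.zero_apply]
  · intro hf
    refine (Submodule.mem_orthogonal _ _).2 fun g hg => ?_
    rw [mem_supportedL2_iff hA] at hg
    rw [L2.inner_def]
    refine integral_eq_zero_of_ae ?_
    filter_upwards [hf, hg] with x h1 h2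
    by_cases hxA : x ∈ A
    · simp [h1 hxA]
    · simp [h2 hxA]

theorem starProjection_supportedL2 {A : Set α} (hA : MeasurableSet A) (f : Lp ℂ 2 μ) :
    (supportedL2 μ A).starProjection f = indicatorL2 hA f := by
  refine (Submodule.eq_starProjection_of_mem_orthogonal (u := f) (indicatorL2_mem hA f) ?_)
  rw [mem_orthogonal_supportedL2_iff hA]
  filter_upwards [Lp.coeFn_sub f (indicatorL2 hA f), coeFn_indicatorL2 hA f] with x h1 h2 hxA
  rw [h1, Pi.sub_apply, h2, Set.indicator_of_mem hxA, sub_self]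

theorem integrable_of_mem_supportedL2 {A : Set α} (hA : MeasurableSet A) (hfin : μ A ≠ ⊤)
    {f : Lp ℂ 2 μ} (hf : f ∈ supportedL2 μ A) : Integrable f μ := by
  rw [mem_supportedL2_iff hA] at hf
  have : IsFiniteMeasure (μ.restrict A) := ⟨by simpa using hfin.lt_top⟩
  have h1 : IntegrableOn f A μ :=
    memLp_one_iff_integrable.1 (((Lp.memLp f).restrict A).mono_exponent (by norm_num))
  refine (h1.integrable_indicator hA).congr ?_
  filter_upwards [hf] with x hx
  by_cases hxA : x ∈ A <;> simp [hxA, hx]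

end L2Support

/-! ### Band-limited functions and the Hilbert–Schmidt bound. -/

section FourierSupport

variable {E : Type*} [NormedAddCommGroup E] [InnerProductSpace ℝ E] [FiniteDimensional ℝ E]
  [MeasurableSpace E] [BorelSpace E]

/-- The closed subspace of `L²` of functions with spectrum in `B`. -/
noncomputable def bandLimitedL2 (B : Set E) : Submodule ℂ (Lp ℂ 2 (volume : Measure E)) :=
  (supportedL2 volume B).comap (Lp.fourierTransformₗᵢ E ℂ).toLinearEquiv.toLinearMap

theorem mem_bandLimitedL2 {B : Set E} {f : Lp ℂ 2 (volume : Measure E)} :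
    f ∈ bandLimitedL2 B ↔ 𝓕 f ∈ supportedL2 volume B := Iff.rfl

instance (B : Set E) : (bandLimitedL2 B).HasOrthogonalProjection := by
  have h : IsClosed (bandLimitedL2 B : Set (Lp ℂ 2 (volume : Measure E))) :=
    (isClosed_supportedL2 B).preimage (Lp.fourierTransformₗᵢ E ℂ).continuous
  have : CompleteSpace (bandLimitedL2 B) := h.completeSpace_coe
  infer_instance

theorem mem_orthogonal_bandLimitedL2_iff {B : Set E} {f : Lp ℂ 2 (volume : Measure E)} :
    f ∈ (bandLimitedL2 B)ᗮ ↔ 𝓕 f ∈ (supportedL2 volume B)ᗮ := by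
  simp only [Submodule.mem_orthogonal, mem_bandLimitedL2]
  constructor
  · intro h g hg
    have hg' : 𝓕 (𝓕⁻ g : Lp ℂ 2 (volume : Measure E)) = g :=
      FourierTransform.fourier_fourierInv_eq g
    rw [← hg', Lp.inner_fourier_eq]
    exact h _ (by rwa [hg'])
  · intro h g hg
    rw [← Lp.inner_fourier_eq]
    exact h _ hg

theorem ae_eq_fourierInv_of_mem_bandLimitedL2 {B : Set E} (hB : MeasurableSet B)
    (hfin : volume B ≠ ⊤) {f : Lp ℂ 2 (volume : Measure E)} (hf : f ∈ bandLimitedL2 B) :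
    f =ᵐ[volume] 𝓕⁻ ((𝓕 f : Lp ℂ 2 (volume : Measure E)) : E → ℂ) := by
  have h := fourierInv_ae_eq_of_integrable (𝓕 f) (integrable_of_mem_supportedL2 hB hfin hf)
  rwa [FourierTransform.fourierInv_fourier_eq] at h

theorem memLp_indicator_fourierChar {B : Set E} (hB : MeasurableSet B) (hfin : volume B ≠ ⊤)
    (t : E) :
    MemLp (B.indicator fun ξ : E => (Real.fourierChar (-inner ℝ ξ t) : ℂ)) 2 volume := by
  have : IsFiniteMeasure (volume.restrict B) := ⟨by simpa using hfin.lt_top⟩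
  rw [memLp_indicator_iff_restrict hB]
  have hc : Continuous fun ξ : E => (Real.fourierChar (-inner ℝ ξ t) : ℂ) :=
    (continuous_subtype_val : Continuous ((↑) : Circle → ℂ)).comp (Real.continuous_fourierChar.comp (by fun_prop))
  exact MemLp.of_bound hc.aestronglyMeasurable 1 (.of_forall fun ξ => (Circle.norm_coe _).le)

/-- The character of frequency variable `ξ ↦ e^{-2πi⟨ξ, t⟩}` cut off to `B`. -/
noncomputable def cutoffCharL2 {B : Set E} (hB : MeasurableSet B) (hfin : volume B ≠ ⊤) (t : E) :
    Lp ℂ 2 (volume : Measure E) :=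
  (memLp_indicator_fourierChar hB hfin t).toLp

theorem ofReal_norm_sq_cutoffCharL2 {B : Set E} (hB : MeasurableSet B) (hfin : volume B ≠ ⊤)
    (t : E) : ENNReal.ofReal (‖cutoffCharL2 hB hfin t‖ ^ 2) = volume B := by
  rw [ofReal_norm_sq_eq_lintegral]
  have h : ∀ᵐ ξ, ‖cutoffCharL2 hB hfin t ξ‖ₑ ^ 2 = B.indicator 1 ξ := by
    filter_upwards [(memLp_indicator_fourierChar hB hfin t).coeFn_toLp] with ξ hξ
    rw [cutoffCharL2, hξ]
    by_cases hξB : ξ ∈ B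
    · rw [Set.indicator_of_mem hξB, Set.indicator_of_mem hξB, ← enorm_norm, Circle.norm_coe]
      simp
    · simp [hξB]
  rw [lintegral_congr_ae h, lintegral_indicator_one hB]

/-- Turns point evaluation of a band-limited function into an inner product with a vector of squared
norm `volume B`, so that Bessel's inequality applies at each `t`. -/
theorem inner_cutoffCharL2 {B : Set E} (hB : MeasurableSet B) (hfin : volume B ≠ ⊤)
    {f : Lp ℂ 2 (volume : Measure E)} (hf : f ∈ supportedL2 volume B) (t : E) :
    inner ℂ (cutoffCharL2 hB hfin t) f = 𝓕⁻ (f : E → ℂ) t := by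
  rw [mem_supportedL2_iff hB] at hf
  rw [L2.inner_def, Real.fourierInv_eq]
  refine integral_congr_ae ?_
  filter_upwards [hf, (memLp_indicator_fourierChar hB hfin t).coeFn_toLp] with ξ h1 h2
  rw [cutoffCharL2, h2]
  by_cases hξB : ξ ∈ B
  · rw [Set.indicator_of_mem hξB, RCLike.inner_apply, Circle.smul_def, smul_eq_mul, mul_comm,
      ← Circle.coe_inv_eq_conj, ← AddChar.map_neg_eq_inv, neg_neg]
  · simp [h1 hξB]

/-- The Hilbert–Schmidt estimate for time and band limiting. -/
theorem sum_norm_sq_starProjection_le {A B : Set E} (hA : MeasurableSet A) (hAfin : volume A ≠ ⊤)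
    (hB : MeasurableSet B) (hBfin : volume B ≠ ⊤) {ι : Type*} (s : Finset ι)
    {e : ι → Lp ℂ 2 (volume : Measure E)} (he : Orthonormal ℂ e)
    (hmem : ∀ i, e i ∈ bandLimitedL2 B) :
    ∑ i ∈ s, ‖(supportedL2 volume A).starProjection (e i)‖ ^ 2 ≤
      volume.real A * volume.real B := by
  -- Bessel's inequality for the orthonormal family `𝓕 (e i)`; integrating over `A` then gives the
  -- product of measures.
  have hpt : ∀ᵐ t, ∑ i ∈ s, ‖e i t‖ₑ ^ 2 ≤ volume B := by
    have h1 : ∀ᵐ t, ∀ i ∈ s, e i t =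
        inner ℂ (cutoffCharL2 hB hBfin t) (𝓕 (e i) : Lp ℂ 2 (volume : Measure E)) := by
      rw [Filter.eventually_all_finset]
      intro i _
      filter_upwards [ae_eq_fourierInv_of_mem_bandLimitedL2 hB hBfin (hmem i)] with t ht
      rw [ht, inner_cutoffCharL2 hB hBfin (mem_bandLimitedL2.1 (hmem i))]
    filter_upwards [h1] with t ht
    have h2 := (he.comp_linearIsometry
      (Lp.fourierTransformₗᵢ E ℂ).toLinearIsometry).sum_inner_products_le (s := s) (cutoffCharL2 hB hBfin t)
    rw [← ofReal_norm_sq_cutoffCharL2 hB hBfin t]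
    refine le_trans (le_of_eq ?_) (ENNReal.ofReal_le_ofReal h2)
    rw [ENNReal.ofReal_sum_of_nonneg (fun _ _ => by positivity)]
    refine Finset.sum_congr rfl fun i hi => ?_
    rw [ht i hi, ENNReal.ofReal_pow (norm_nonneg _), ofReal_norm, ← enorm_norm,
      norm_inner_symm, enorm_norm]
    rfl
  have h3 : ∀ i, ENNReal.ofReal (‖(supportedL2 volume A).starProjection (e i)‖ ^ 2) =
      ∫⁻ t in A, ‖e i t‖ₑ ^ 2 := by
    intro i
    rw [starProjection_supportedL2 hA, ofReal_norm_sq_eq_lintegral, ← lintegral_indicator hA]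
    refine lintegral_congr_ae ?_
    filter_upwards [coeFn_indicatorL2 hA (e i)] with t ht
    rw [ht]
    by_cases htA : t ∈ A <;> simp [htA]
  have h4 : ENNReal.ofReal (∑ i ∈ s, ‖(supportedL2 volume A).starProjection (e i)‖ ^ 2) ≤
      volume B * volume A := by
    rw [ENNReal.ofReal_sum_of_nonneg (fun _ _ => by positivity), Finset.sum_congr rfl fun i _ => h3 i,
      ← lintegral_finsetSum' _ fun i _ =>
        ((Lp.aestronglyMeasurable (e i)).enorm.pow_const 2).restrict, ← setLIntegral_const]
    exact lintegral_mono_ae (ae_restrict_of_ae hpt)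
  rw [← ENNReal.ofReal_le_ofReal_iff (by positivity), ENNReal.ofReal_mul (by positivity),
    ofReal_measureReal hAfin, ofReal_measureReal hBfin, mul_comm]
  exact h4

/-- The product of time and band limiting projections to sets of finite measure is compact. -/
theorem isCompactOperator_starProjection_comp {A B : Set E} (hA : MeasurableSet A)
    (hAfin : volume A ≠ ⊤) (hB : MeasurableSet B) (hBfin : volume B ≠ ⊤) :
    IsCompactOperator
      ((supportedL2 volume A).starProjection ∘L (bandLimitedL2 B).starProjection) := by
  -- The bound concerns orthonormal families of band-limited functions, hence the restriction to
  -- that subspace.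
  have h : IsCompactOperator
      ((supportedL2 volume A).starProjection ∘L (bandLimitedL2 B).subtypeL) := by
    refine isCompactOperator_of_sum_norm_sq_le _ (volume.real A * volume.real B) fun s hs => ?_
    have h1 := sum_norm_sq_starProjection_le hA hAfin hB hBfin Finset.univ
      (hs.comp_linearIsometry (bandLimitedL2 B).subtypeₗᵢ) (fun i => i.1.2)
    rw [← Finset.sum_coe_sort]
    exact h1
  exact h.comp_clm (bandLimitedL2 B).orthogonalProjectionOnto

/-- A bound for the number of independent functions supported in `A` with spectrum in `B`. -/
theorem card_le_of_linearIndependent {A B : Set E} (hA : MeasurableSet A)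
    (hAfin : volume A ≠ ⊤) (hB : MeasurableSet B) (hBfin : volume B ≠ ⊤) {n : ℕ}
    {f : Fin n → Lp ℂ 2 (volume : Measure E)} (hf : LinearIndependent ℂ f)
    (hmem : ∀ i, f i ∈ supportedL2 volume A ⊓ bandLimitedL2 B) :
    (n : ℝ) ≤ volume.real A * volume.real B := by
  set W := Submodule.span ℂ (Set.range f)
  have hW : W ≤ supportedL2 volume A ⊓ bandLimitedL2 B :=
    Submodule.span_le.2 (Set.range_subset_iff.2 hmem)
  have hfr : Module.finrank ℂ W = n := by simpa using finrank_span_eq_card hf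
  have : FiniteDimensional ℂ W := FiniteDimensional.span_of_finite ℂ (Set.finite_range f)
  -- The projection fixes each basis vector, so the Hilbert–Schmidt sum is the dimension of `W`.
  set b := stdOrthonormalBasis ℂ W
  have h := sum_norm_sq_starProjection_le hA hAfin hB hBfin Finset.univ
      (b.orthonormal.comp_linearIsometry W.subtypeₗᵢ) (fun i => (hW (b i).2).2)
  have h1 : ∀ i, ‖(supportedL2 volume A).starProjection ((W.subtypeₗᵢ ∘ b) i)‖ ^ 2 = 1 := by
    intro i
    rw [Function.comp_apply, Submodule.coe_subtypeₗᵢ, Submodule.coe_subtype,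
      Submodule.starProjection_eq_self_iff.2 (hW (b i).2).1, ← Submodule.coe_norm, b.norm_eq_one,
      one_pow]
  rw [Finset.sum_congr rfl fun i _ => h1 i] at h
  simpa [hfr] using h

end FourierSupport

/-! ### Translates and the uncertainty principle. -/

section Translation

variable {E : Type*} [NormedAddCommGroup E] [InnerProductSpace ℝ E] [FiniteDimensional ℝ E]
  [MeasurableSpace E] [BorelSpace E]

-- The change is at most the measure of the symmetric difference of two translates of `S`, which
-- tends to 0. This prepares an intermediate value argument.
open scoped symmDiff in
theorem continuous_measureReal_translate_diff {S A : Set E} (hS : MeasurableSet S)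
    (hSfin : volume S ≠ ⊤) :
    Continuous fun h : E => volume.real ((fun t => t - h) ⁻¹' S \ A) := by
  have hmp : ∀ h : E, MeasurePreserving (fun t : E => t - h) volume volume :=
    fun h => measurePreserving_sub_right volume h
  have hfin : ∀ h : E, volume ((fun t => t - h) ⁻¹' S) ≠ ⊤ := fun h => by
    rwa [(hmp h).measure_preimage hS.nullMeasurableSet]
  let F : C(E, C(E, E)) := ContinuousMap.curry ⟨fun p : E × E => p.2 - p.1, by fun_prop⟩
  refine continuous_iff_continuousAt.2 fun h₀ => ?_
  have h1 := tendsto_measure_symmDiff_preimage_nhds_zero (μ := volume) (ν := volume)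
    (F.continuous.tendsto h₀) (.of_forall hmp) (hmp h₀) hS.nullMeasurableSet hSfin
  have h2 := (ENNReal.tendsto_toReal ENNReal.zero_ne_top).comp h1
  refine tendsto_iff_dist_tendsto_zero.2
    (squeeze_zero (fun _ => dist_nonneg) (fun h => ?_) h2)
  have key : ∀ a b : E, volume.real ((fun t => t - a) ⁻¹' S \ A) ≤
      volume.real ((fun t => t - b) ⁻¹' S \ A) +
        volume.real (((fun t => t - a) ⁻¹' S) ∆ ((fun t => t - b) ⁻¹' S)) := by
    intro a b
    refine (measureReal_mono ?_ ?_).trans (measureReal_union_le _ _)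
    · intro t ht
      by_cases htb : t ∈ (fun t => t - b) ⁻¹' S
      · exact Or.inl ⟨htb, ht.2⟩
      · exact Or.inr (Or.inl ⟨ht.1, htb⟩)
    · exact (measure_union_lt_top ((measure_mono Set.sdiff_subset).trans_lt (hfin b).lt_top)
        ((measure_mono symmDiff_le_sup).trans_lt
          (measure_union_lt_top (hfin a).lt_top (hfin b).lt_top))).ne
  have k1 := key h h₀
  have k2 := key h₀ h
  rw [symmDiff_comm] at k2
  rw [Real.dist_eq, abs_le]
  change -volume.real (((fun t => t - h) ⁻¹' S) ∆ ((fun t => t - h₀) ⁻¹' S)) ≤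
      volume.real ((fun t => t - h) ⁻¹' S \ A) - volume.real ((fun t => t - h₀) ⁻¹' S \ A) ∧
    volume.real ((fun t => t - h) ⁻¹' S \ A) - volume.real ((fun t => t - h₀) ⁻¹' S \ A) ≤
      volume.real (((fun t => t - h) ⁻¹' S) ∆ ((fun t => t - h₀) ⁻¹' S))
  exact ⟨by linarith, by linarith⟩

/-- Otherwise `A` meets every translate of `S` in measure `volume S`. Integrated over all
translations this is infinite, whereas Tonelli gives `volume A * volume S`. -/
theorem exists_translate_diff_pos [Nontrivial E] {S A : Set E} (hS : MeasurableSet S)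
    (hSpos : volume S ≠ 0) (hSfin : volume S ≠ ⊤) (hA : MeasurableSet A) (hAfin : volume A ≠ ⊤) :
    ∃ h : E, volume ((fun t => t - h) ⁻¹' S \ A) ≠ 0 := by
  by_contra! hcon
  have h1 : ∀ h : E, volume S ≤ ∫⁻ t, A.indicator 1 t * S.indicator 1 (t - h) := by
    intro h
    have h2 : volume ((fun t => t - h) ⁻¹' S) = volume S :=
      (measurePreserving_sub_right volume h).measure_preimage hS.nullMeasurableSet
    have hm : MeasurableSet ((fun t => t - h) ⁻¹' S ∩ A) :=
      ((measurable_id.sub_const h) hS).inter hA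
    have h3 : ∫⁻ t, A.indicator 1 t * S.indicator 1 (t - h) =
        volume ((fun t => t - h) ⁻¹' S ∩ A) := by
      rw [← lintegral_indicator_one hm]
      congr 1 with t
      by_cases h4 : t ∈ A <;> by_cases h5 : t - h ∈ S <;> simp [h4, h5]
    rw [h3, ← h2]
    exact (measure_le_inter_add_sdiff _ _ A).trans (by rw [hcon h, add_zero])
  have h6 : ∫⁻ h : E, ∫⁻ t, A.indicator 1 t * S.indicator 1 (t - h) =
      volume A * volume S := by
    rw [lintegral_lintegral_swap]
    · have h7 : ∀ t, ∫⁻ h : E, A.indicator 1 t * S.indicator 1 (t - h) =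
          A.indicator 1 t * volume S := by
        intro t
        rw [lintegral_const_mul _ (by
          exact (measurable_one.indicator hS).comp (measurable_const.sub measurable_id)),
          lintegral_sub_left_eq_self (S.indicator 1) t, lintegral_indicator_one hS]
      simp_rw [h7]
      rw [lintegral_mul_const _ (measurable_one.indicator hA), lintegral_indicator_one hA]
    · refine Measurable.aemeasurable (Measurable.mul ?_ ?_)
      · exact (measurable_one.indicator hA).comp measurable_snd
      · exact (measurable_one.indicator hS).comp (measurable_snd.sub measurable_fst)
  have h8 : (⊤ : ENNReal) ≤ volume A * volume S := by
    rw [← h6]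
    refine le_trans ?_ (lintegral_mono h1)
    rw [lintegral_const, measure_univ_of_isAddLeftInvariant, ENNReal.mul_top hSpos]
  exact ENNReal.mul_ne_top hAfin hSfin (top_le_iff.1 h8)

/-- Small translations enlarge a set slightly, but not by a null set. -/
theorem exists_translate_diff_pos_le [Nontrivial E] {S A : Set E} (hS : MeasurableSet S)
    (hSpos : volume S ≠ 0) (hSfin : volume S ≠ ⊤) (hA : MeasurableSet A) (hAfin : volume A ≠ ⊤)
    (hSA : S ⊆ A) {ε : ℝ} (hε : 0 < ε) :
    ∃ h : E, 0 < volume.real ((fun t => t - h) ⁻¹' S \ A) ∧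
      volume.real ((fun t => t - h) ⁻¹' S \ A) ≤ ε := by
  obtain ⟨h₁, hh₁⟩ := exists_translate_diff_pos hS hSpos hSfin hA hAfin
  have hpos : 0 < volume.real ((fun t => t - h₁) ⁻¹' S \ A) := by
    refine ENNReal.toReal_pos hh₁ (ne_top_of_le_ne_top hSfin ?_)
    refine (measure_mono Set.sdiff_subset).trans_eq ?_
    exact (measurePreserving_sub_right volume h₁).measure_preimage hS.nullMeasurableSet
  -- Intermediate values between `h = 0`, where the excess is empty since `S ⊆ A`, and `h₁`.
  have hr := mem_range_of_exists_le_of_exists_ge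
    (continuous_measureReal_translate_diff hS hSfin)
    (c := min ε (volume.real ((fun t => t - h₁) ⁻¹' S \ A)))
    ⟨0, by simp [Set.sdiff_eq_empty.2 hSA, hε.le]⟩ ⟨h₁, min_le_right _ _⟩
  obtain ⟨h, hh⟩ := hr
  refine ⟨h, ?_, ?_⟩
  · exact (lt_min hε hpos).trans_eq hh.symm
  · exact hh.le.trans (min_le_left _ _)

/-- Translates of a function with spectrum in `B` have spectrum in `B`. -/
theorem exists_translate_mem_bandLimitedL2 {B : Set E} (hB : MeasurableSet B)
    (hBfin : volume B ≠ ⊤) {f : Lp ℂ 2 (volume : Measure E)} (hf : f ∈ bandLimitedL2 B) (h : E) :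
    ∃ g ∈ bandLimitedL2 B, g =ᵐ[volume] fun t => f (t - h) := by
  set F : Lp ℂ 2 (volume : Measure E) := 𝓕 f
  have hF : F ∈ supportedL2 volume B := hf
  have hc : Continuous fun ξ : E => (Real.fourierChar (-inner ℝ ξ h) : ℂ) :=
    (continuous_subtype_val : Continuous ((↑) : Circle → ℂ)).comp
      (Real.continuous_fourierChar.comp (by fun_prop))
  -- Modulating the transform translates the function and keeps the spectrum in `B`.
  have hG : MemLp (fun ξ : E => (Real.fourierChar (-inner ℝ ξ h) : ℂ) * F ξ) 2 volume :=
    (Lp.memLp F).of_le (hc.aestronglyMeasurable.mul (Lp.aestronglyMeasurable F))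
      (.of_forall fun ξ => by rw [norm_mul, Circle.norm_coe, one_mul])
  have hGB : hG.toLp ∈ supportedL2 volume B := by
    rw [mem_supportedL2_iff hB] at hF ⊢
    filter_upwards [hF, hG.coeFn_toLp] with ξ h1 h2 hξ
    rw [h2, h1 hξ, mul_zero]
  have hinv : 𝓕 (𝓕⁻ hG.toLp : Lp ℂ 2 (volume : Measure E)) = hG.toLp :=
    FourierTransform.fourier_fourierInv_eq _
  have hg : (𝓕⁻ hG.toLp : Lp ℂ 2 (volume : Measure E)) ∈ bandLimitedL2 B := by
    rwa [mem_bandLimitedL2, hinv]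
  refine ⟨_, hg, ?_⟩
  have h1 := ae_eq_fourierInv_of_mem_bandLimitedL2 hB hBfin hg
  have h2 := (measurePreserving_sub_right (volume : Measure E) h).quasiMeasurePreserving.ae
    (ae_eq_fourierInv_of_mem_bandLimitedL2 hB hBfin hf)
  rw [hinv] at h1
  filter_upwards [h1, h2] with t ht1 ht2
  rw [ht1, ht2, Real.fourierInv_eq, Real.fourierInv_eq]
  refine integral_congr_ae ?_
  filter_upwards [hG.coeFn_toLp] with ξ hξ
  rw [hξ, inner_sub_right, sub_eq_add_neg, AddChar.map_add_eq_mul, Circle.smul_def, Circle.smul_def,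
    Circle.coe_mul, smul_eq_mul, smul_eq_mul, mul_assoc]

/-- Arbitrarily many independent functions with spectrum in `B` on a set of bounded measure. -/
theorem exists_linearIndependent_translates [Nontrivial E] {S B : Set E} (hS : MeasurableSet S)
    (hSpos : volume S ≠ 0) (hSfin : volume S ≠ ⊤) (hB : MeasurableSet B) (hBfin : volume B ≠ ⊤)
    {f : Lp ℂ 2 (volume : Measure E)} (hfB : f ∈ bandLimitedL2 B)
    (hfS : ∀ t, f t ≠ 0 ↔ t ∈ S) {ε : ℝ} (hε : 0 < ε) (n : ℕ) :
    ∃ A : Set E, MeasurableSet A ∧ S ⊆ A ∧ volume A ≠ ⊤ ∧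
      volume.real A ≤ volume.real S + n * ε ∧
      ∃ g : Fin n → Lp ℂ 2 (volume : Measure E), LinearIndependent ℂ g ∧
        ∀ i, g i ∈ supportedL2 volume A ⊓ bandLimitedL2 B := by
  induction n with
  | zero =>
    exact ⟨S, hS, subset_rfl, hSfin, by simp, Fin.elim0, linearIndependent_empty_type,
      fun i => i.elim0⟩
  | succ n ih =>
    obtain ⟨A, hA, hSA, hAfin, hAle, g, hg, hgm⟩ := ih
    obtain ⟨h, hpos, hle⟩ := exists_translate_diff_pos_le hS hSpos hSfin hA hAfin hSA hε
    obtain ⟨k, hkB, hk⟩ := exists_translate_mem_bandLimitedL2 hB hBfin hfB h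
    set D := (fun t => t - h) ⁻¹' S \ A
    have hD : MeasurableSet D := ((measurable_id.sub_const h) hS).diff hA
    have hDfin : volume D ≠ ⊤ := fun h0 => by simp [measureReal_def, h0] at hpos
    have hAD : MeasurableSet (A ∪ D) := hA.union hD
    refine ⟨A ∪ D, hAD, hSA.trans Set.subset_union_left,
      (measure_union_lt_top hAfin.lt_top hDfin.lt_top).ne, ?_, Fin.cons k g, ?_, ?_⟩
    · have := measureReal_union_le (μ := volume) A D
      push_cast
      linarith
    -- The span of `g` vanishes off `A`, but `k` is nonzero almost everywhere on `D`, which has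
    -- positive measure.
    · refine linearIndependent_finCons.2 ⟨hg, fun hks => ?_⟩
      have hsp : Submodule.span ℂ (Set.range g) ≤ supportedL2 volume A :=
        Submodule.span_le.2 (Set.range_subset_iff.2 fun i => (hgm i).1)
      have h1 := (mem_supportedL2_iff hA).1 (hsp hks)
      have h2 : volume D = 0 := by
        refine measure_eq_zero_iff_ae_notMem.2 ?_
        filter_upwards [h1, hk] with t ht1 ht2 htD
        exact (hfS (t - h)).2 htD.1 (ht2 ▸ ht1 htD.2)
      simp [measureReal_def, h2] at hpos
    · refine Fin.cases ?_ ?_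
      · refine ⟨(mem_supportedL2_iff hAD).2 ?_, hkB⟩
        filter_upwards [hk] with t ht htAD
        rw [Fin.cons_zero, ht]
        by_contra h3
        have h4 : t - h ∈ S := (hfS _).1 h3
        exact htAD (by by_cases htA : t ∈ A; exacts [Or.inl htA, Or.inr ⟨h4, htA⟩])
      · intro i
        refine ⟨(mem_supportedL2_iff hAD).2 ?_, (hgm i).2⟩
        filter_upwards [(mem_supportedL2_iff hA).1 (hgm i).1] with t ht htAD
        exact ht fun htA => htAD (Or.inl htA)

/-- The Amrein–Berthier–Benedicks uncertainty principle: no nonzero `L²` function is supported in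
a set of finite measure together with its Fourier transform. -/
theorem supportedL2_inf_bandLimitedL2_eq_bot [Nontrivial E] {A B : Set E} (hA : MeasurableSet A)
    (hAfin : volume A ≠ ⊤) (hB : MeasurableSet B) (hBfin : volume B ≠ ⊤) :
    supportedL2 volume A ⊓ bandLimitedL2 B = ⊥ := by
  refine (Submodule.eq_bot_iff _).2 fun f hf => ?_
  by_contra hf0
  set S : Set E := {t | f t ≠ 0}
  have hS : MeasurableSet S :=
    (Lp.stronglyMeasurable f).measurable (measurableSet_singleton 0).compl
  have hSA : S ≤ᵐ[volume] A := by
    filter_upwards [(mem_supportedL2_iff hA).1 hf.1] with t ht htS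
    by_contra htA
    exact htS (ht htA)
  have hSfin : volume S ≠ ⊤ := ((measure_mono_ae hSA).trans_lt hAfin.lt_top).ne
  have hSpos : volume S ≠ 0 := fun h0 => hf0 <| (Lp.eq_zero_iff_ae_eq_zero).2 <| by
    filter_upwards [measure_eq_zero_iff_ae_notMem.1 h0] with t ht
    simpa [S] using ht
  set b := volume.real B
  have hb : 0 ≤ b := measureReal_nonneg
  -- With `ε = 1 / (2 * (b + 1))`, the dimension bound reads `n ≤ volume.real S * b + n / 2`, which
  -- this `n` violates; `b + 1` avoids dividing by zero.
  obtain ⟨n, hn⟩ := exists_nat_gt (volume.real S * b * 2)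
  obtain ⟨A', hA', -, hA'fin, hle, g, hg, hgm⟩ :=
    exists_linearIndependent_translates hS hSpos hSfin hB hBfin hf.2 (fun t => Iff.rfl)
      (ε := 1 / (2 * (b + 1))) (by positivity) n
  have h1 := card_le_of_linearIndependent hA' hA'fin hB hBfin hg hgm
  have h2 : volume.real A' * b ≤ (volume.real S + n * (1 / (2 * (b + 1)))) * b := by gcongr
  have h3 : (n : ℝ) * (1 / (2 * (b + 1))) * b ≤ n / 2 := by
    rw [mul_assoc, div_eq_mul_inv (n : ℝ) 2]
    gcongr
    rw [div_mul_eq_mul_div, div_le_iff₀ (by positivity)]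
    linarith
  have h4 : (n : ℝ) ≤ volume.real A' * b := h1
  linarith

end Translation

/-! ### Complex-valued prescription; conjugation and the transform. -/

section Conjugation

variable {E : Type*} [NormedAddCommGroup E] [InnerProductSpace ℝ E] [FiniteDimensional ℝ E]
  [MeasurableSpace E] [BorelSpace E]

/-- An `L²` function and its Fourier transform can be prescribed independently on two sets of
finite measure. -/
theorem exists_eq_on_and_fourier_eq_on [Nontrivial E] {A B : Set E} (hA : MeasurableSet A)
    (hAfin : volume A ≠ ⊤) (hB : MeasurableSet B) (hBfin : volume B ≠ ⊤)
    (w u : Lp ℂ 2 (volume : Measure E)) :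
    ∃ x : Lp ℂ 2 (volume : Measure E), (∀ᵐ t, t ∈ A → x t = w t) ∧
      ∀ᵐ ξ, ξ ∈ B → (𝓕 x : Lp ℂ 2 (volume : Measure E)) ξ =
        (𝓕 u : Lp ℂ 2 (volume : Measure E)) ξ := by
  -- `y` equals `w - u` on `A` and has zero transform on `B`, so `y + u` is the solution.
  obtain ⟨y, hy, hyw⟩ := exists_mem_orthogonal_sub_mem_orthogonal (supportedL2 volume A)
    (bandLimitedL2 B) (isCompactOperator_starProjection_comp hA hAfin hB hBfin)
    (supportedL2_inf_bandLimitedL2_eq_bot hA hAfin hB hBfin) (w - u)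
  rw [mem_orthogonal_bandLimitedL2_iff, mem_orthogonal_supportedL2_iff hB] at hy
  rw [mem_orthogonal_supportedL2_iff hA] at hyw
  refine ⟨y + u, ?_, ?_⟩
  · filter_upwards [hyw, Lp.coeFn_sub y (w - u), Lp.coeFn_sub w u, Lp.coeFn_add y u]
      with t h1 h2 h3 h4 ht
    have h5 := h1 ht
    rw [h2, Pi.sub_apply, h3, Pi.sub_apply] at h5
    rw [h4, Pi.add_apply]
    linear_combination h5
  · rw [FourierTransform.fourier_add]
    filter_upwards [hy, Lp.coeFn_add (𝓕 y : Lp ℂ 2 (volume : Measure E)) (𝓕 u)] with ξ h1 h2 hξ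
    rw [h2, Pi.add_apply, h1 hξ, zero_add]

theorem fourier_conj (f : E → ℂ) (ξ : E) :
    𝓕 (fun t => conj (f t)) ξ = conj (𝓕 f (-ξ)) := by
  rw [Real.fourier_eq, Real.fourier_eq, ← integral_conj]
  refine integral_congr_ae (.of_forall fun t => ?_)
  simp only [inner_neg_right, neg_neg, Circle.smul_def, smul_eq_mul, map_mul,
    ← Circle.coe_inv_eq_conj, ← AddChar.map_neg_eq_inv]

/-- Both sides are continuous in `f`, so the integral identity `fourier_conj` on the dense Schwartz
functions suffices. -/
theorem fourier_conj_compLp (f : Lp ℂ 2 (volume : Measure E)) :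
    (𝓕 (Complex.conjCLE.toContinuousLinearMap.compLp f) : Lp ℂ 2 (volume : Measure E)) =ᵐ[volume]
      fun ξ => conj ((𝓕 f : Lp ℂ 2 (volume : Measure E)) (-ξ)) := by
  set L : ℂ →L[ℝ] ℂ := Complex.conjCLE.toContinuousLinearMap
  have hneg := Measure.measurePreserving_neg (volume : Measure E)
  have hcomp : ∀ g : Lp ℂ 2 (volume : Measure E),
      Lp.compMeasurePreserving Neg.neg hneg (L.compLp g) =ᵐ[volume] fun ξ => conj (g (-ξ)) := by
    intro g
    filter_upwards [Lp.coeFn_compMeasurePreserving (L.compLp g) hneg,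
      hneg.quasiMeasurePreserving.ae (L.coeFn_compLp g)] with ξ h1 h2
    rw [h1, Function.comp_apply, h2]
    rfl
  suffices h : (𝓕 (L.compLp f) : Lp ℂ 2 (volume : Measure E)) =
      Lp.compMeasurePreserving Neg.neg hneg (L.compLp (𝓕 f)) by
    rw [h]
    exact hcomp _
  have hLc : Continuous fun g : Lp ℂ 2 (volume : Measure E) => L.compLp g :=
    (L.compLpL 2 (volume : Measure E)).continuous
  have hFc : Continuous fun g : Lp ℂ 2 (volume : Measure E) =>
      (𝓕 g : Lp ℂ 2 (volume : Measure E)) := (Lp.fourierTransformₗᵢ E ℂ).continuous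
  refine DenseRange.induction_on (p := fun f : Lp ℂ 2 (volume : Measure E) =>
      (𝓕 (L.compLp f) : Lp ℂ 2 (volume : Measure E)) =
        Lp.compMeasurePreserving Neg.neg hneg (L.compLp (𝓕 f)))
    (SchwartzMap.denseRange_toLpCLM (F := ℂ) (p := 2) ENNReal.ofNat_ne_top) f ?_ ?_
  · exact isClosed_eq (hFc.comp hLc)
      ((Lp.isometry_compMeasurePreserving hneg).continuous.comp (hLc.comp hFc))
  · intro φ
    have h1 : L.compLp (φ.toLp 2 (volume : Measure E)) =
        (φ.postcompCLM L).toLp 2 (volume : Measure E) := by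
      refine Lp.ext ?_
      filter_upwards [L.coeFn_compLp (φ.toLp 2 (volume : Measure E)),
        φ.coeFn_toLp 2 (volume : Measure E),
        (φ.postcompCLM L).coeFn_toLp 2 (volume : Measure E)] with t h2 h3 h4
      rw [h2, h3, h4, SchwartzMap.postcompCLM_apply]
    rw [SchwartzMap.toLpCLM_apply, h1, SchwartzMap.toLp_fourier_eq, SchwartzMap.toLp_fourier_eq]
    refine Lp.ext ?_
    filter_upwards [hcomp ((𝓕 φ).toLp 2), (𝓕 (φ.postcompCLM L)).coeFn_toLp 2 (volume : Measure E),
      hneg.quasiMeasurePreserving.ae ((𝓕 φ).coeFn_toLp 2 (volume : Measure E))] with ξ h2 h3 h4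
    rw [h2, h3, h4, SchwartzMap.fourier_coe, SchwartzMap.fourier_coe, ← fourier_conj]
    rfl

end Conjugation

/-! ### Descent to real scalars. -/

section RealOrComplex

theorem RCLike.map_map_complex {𝕜 : Type*} [RCLike 𝕜] (z : 𝕜) :
    RCLike.map ℂ 𝕜 (RCLike.map 𝕜 ℂ z) = z := by
  rcases RCLike.I_eq_zero_or_im_I_eq_one (K := 𝕜) with h | h
  · have hz := RCLike.re_add_im z
    rw [h, mul_zero, add_zero] at hz
    simp [RCLike.map_apply, h, hz]
  · simp [RCLike.map_apply, RCLike.re_add_im]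

theorem RCLike.complex_map_map_of_im_I_eq_one {𝕜 : Type*} [RCLike 𝕜]
    (h : RCLike.im (RCLike.I : 𝕜) = 1) (z : ℂ) : RCLike.map 𝕜 ℂ (RCLike.map ℂ 𝕜 z) = z := by
  simp [RCLike.map_apply, h]

theorem RCLike.complex_map_map_of_I_eq_zero {𝕜 : Type*} [RCLike 𝕜]
    (h : (RCLike.I : 𝕜) = 0) (z : ℂ) :
    RCLike.map 𝕜 ℂ (RCLike.map ℂ 𝕜 z) = (1 / 2 : ℂ) * (z + conj z) := by
  rw [Complex.add_conj]
  simp [RCLike.map_apply, h]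

theorem RCLike.conj_map_complex_of_I_eq_zero {𝕜 : Type*} [RCLike 𝕜]
    (h : (RCLike.I : 𝕜) = 0) (z : 𝕜) :
    conj (RCLike.map 𝕜 ℂ z) = RCLike.map 𝕜 ℂ z := by
  have hz : RCLike.im z = 0 := by
    rw [← RCLike.re_add_im z, h]
    simp
  simp [RCLike.map_apply, hz]

/-- An `L²` function with values in `ℝ` or `ℂ` and its Fourier transform can be prescribed
independently on two sets of finite measure. -/
theorem exists_eq_on_and_fourierL2_eq_on {𝕜 : Type*} [RCLike 𝕜] {N : ℕ} (hN : 1 ≤ N)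
    {A B : Set (EuclideanSpace ℝ (Fin N))} (hA : MeasurableSet A) (hAfin : volume A ≠ ⊤)
    (hB : MeasurableSet B) (hBfin : volume B ≠ ⊤)
    (w u : Lp 𝕜 2 (volume : Measure (EuclideanSpace ℝ (Fin N)))) :
    ∃ x : Lp 𝕜 2 (volume : Measure (EuclideanSpace ℝ (Fin N))),
      (∀ᵐ t, t ∈ A → x t = w t) ∧ ∀ᵐ ξ, ξ ∈ B → fourierL2 x ξ = fourierL2 u ξ := by
  have : Nonempty (Fin N) := ⟨⟨0, hN⟩⟩
  have hneg := Measure.measurePreserving_neg (volume : Measure (EuclideanSpace ℝ (Fin N)))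
  set ι : 𝕜 →L[ℝ] ℂ := RCLike.map 𝕜 ℂ
  set ρ : ℂ →L[ℝ] 𝕜 := RCLike.map ℂ 𝕜
  have hBn : MeasurableSet (Neg.neg ⁻¹' B) := hneg.measurable hB
  -- In the real case the transform of the real part of `X` at `ξ` involves `𝓕 X` at both `ξ` and
  -- `-ξ`, hence `B ∪ -B`.
  obtain ⟨X, hX, hXB⟩ := exists_eq_on_and_fourier_eq_on hA hAfin (hB.union hBn)
    (measure_union_lt_top hBfin.lt_top
      ((hneg.measure_preimage hB.nullMeasurableSet).trans_lt hBfin.lt_top)).ne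
    (ι.compLp w) (ι.compLp u)
  refine ⟨ρ.compLp X, ?_, ?_⟩
  · filter_upwards [hX, ρ.coeFn_compLp X, ι.coeFn_compLp w] with t h1 h2 h3 ht
    rw [h2, h1 ht, h3]
    exact RCLike.map_map_complex _
  rcases RCLike.I_eq_zero_or_im_I_eq_one (K := 𝕜) with hI | hI
  · set κ : ℂ →L[ℝ] ℂ := Complex.conjCLE.toContinuousLinearMap
    have h1 : ι.compLp (ρ.compLp X) = (1 / 2 : ℂ) • (X + κ.compLp X) := by
      refine Lp.ext ?_
      filter_upwards [ι.coeFn_compLp (ρ.compLp X), ρ.coeFn_compLp X, κ.coeFn_compLp X,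
        Lp.coeFn_smul (1 / 2 : ℂ) (X + κ.compLp X), Lp.coeFn_add X (κ.compLp X)]
        with t h1 h2 h3 h4 h5
      rw [h1, h2, h4, Pi.smul_apply, h5, Pi.add_apply, h3, smul_eq_mul]
      exact RCLike.complex_map_map_of_I_eq_zero hI _
    have h2 : κ.compLp (ι.compLp u) = ι.compLp u := by
      refine Lp.ext ?_
      filter_upwards [κ.coeFn_compLp (ι.compLp u), ι.coeFn_compLp u] with t h1 h2
      rw [h1, h2]
      exact RCLike.conj_map_complex_of_I_eq_zero hI _
    have h3 := fourier_conj_compLp (ι.compLp u)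
    rw [h2] at h3
    change ∀ᵐ ξ, ξ ∈ B → (𝓕 (ι.compLp (ρ.compLp X)) :
      Lp ℂ 2 (volume : Measure (EuclideanSpace ℝ (Fin N)))) ξ = (𝓕 (ι.compLp u) :
      Lp ℂ 2 (volume : Measure (EuclideanSpace ℝ (Fin N)))) ξ
    rw [h1, FourierTransform.fourier_smul, FourierTransform.fourier_add]
    filter_upwards [hXB, hneg.quasiMeasurePreserving.ae hXB, h3, fourier_conj_compLp X,
      Lp.coeFn_smul (1 / 2 : ℂ) ((𝓕 X : Lp ℂ 2 (volume : Measure (EuclideanSpace ℝ (Fin N)))) +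
        𝓕 (κ.compLp X)),
      Lp.coeFn_add (𝓕 X : Lp ℂ 2 (volume : Measure (EuclideanSpace ℝ (Fin N))))
        (𝓕 (κ.compLp X))] with ξ k1 k2 k3 k4 k5 k6 hξ
    rw [k5, Pi.smul_apply, k6, Pi.add_apply, k4, k1 (Or.inl hξ),
      k2 (Or.inr (by simpa using hξ)), ← k3, smul_eq_mul]
    ring
  · have h1 : ι.compLp (ρ.compLp X) = X := by
      refine Lp.ext ?_
      filter_upwards [ι.coeFn_compLp (ρ.compLp X), ρ.coeFn_compLp X] with t h1 h2
      rw [h1, h2]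
      exact RCLike.complex_map_map_of_im_I_eq_one hI _
    filter_upwards [hXB] with ξ h2 hξ
    change (𝓕 (ι.compLp (ρ.compLp X)) :
      Lp ℂ 2 (volume : Measure (EuclideanSpace ℝ (Fin N)))) ξ = _
    rw [h1]
    exact h2 (Or.inl hξ)

end RealOrComplex

/-! ### Prescribing moments off `A`. -/

section Moments

variable {𝕜 : Type*} [RCLike 𝕜] {α : Type*} [MeasurableSpace α] {μ : Measure α}

theorem integrable_mul_conj (f g : Lp 𝕜 2 μ) : Integrable (fun t => f t * conj (g t)) μ := by
  simpa [RCLike.inner_apply] using L2.integrable_inner (𝕜 := 𝕜) g f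

theorem setIntegral_mul_conj_self_ne_zero (v : Lp 𝕜 2 μ) {D : Set α}
    (hpos : 0 < μ (Function.support v ∩ D)) : ∫ t in D, v t * conj (v t) ∂μ ≠ 0 := by
  have h1 : ∀ t, v t * conj (v t) = ((‖v t‖ ^ 2 : ℝ) : 𝕜) := fun t => by
    rw [RCLike.mul_conj, RCLike.ofReal_pow]
  simp_rw [h1]
  rw [integral_ofReal, RCLike.ofReal_ne_zero]
  refine ne_of_gt ((setIntegral_pos_iff_support_of_nonneg_ae
    (.of_forall fun t => by positivity) ?_).2 ?_)
  · exact (Lp.memLp v).norm.integrable_sq.integrableOn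
  · convert hpos using 3
    ext t
    simp

/-- On the union of `A` and the disjoint supports of the `v i`, there is an `L²` function equal
to `g` on `A` whose moments against the `v i` are prescribed. -/
theorem exists_eq_on_and_integral_mul_conj_eq {ι : Type*} [Fintype ι] {A : Set α}
    (hA : MeasurableSet A) (v : ι → Lp 𝕜 2 μ)
    (hdisj : Pairwise fun i j => AEDisjoint μ (Function.support (v i)) (Function.support (v j)))
    (hpos : ∀ i, 0 < μ (Function.support (v i) ∩ Aᶜ)) (g : Lp 𝕜 2 μ) (η : ι → 𝕜) :
    ∃ w : Lp 𝕜 2 μ, (∀ᵐ t ∂μ, t ∈ A → w t = g t) ∧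
      ∀ i, ∫ t, w t * conj (v i t) ∂μ = η i := by
  set a : ι → 𝕜 := fun i => ∫ t in A, g t * conj (v i t) ∂μ
  set b : ι → 𝕜 := fun i => ∫ t in Aᶜ, v i t * conj (v i t) ∂μ
  have hb : ∀ i, b i ≠ 0 := fun i => setIntegral_mul_conj_self_ne_zero (v i) (hpos i)
  -- Disjoint supports kill the cross terms, so the moment of `w` against `v i` is `a i + c i * b
  -- i`.
  set c : ι → 𝕜 := fun i => (η i - a i) / b i
  have hW : MemLp (fun t => A.indicator g t + ∑ i, Aᶜ.indicator (fun s => c i * v i s) t) 2 μ :=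
    ((Lp.memLp g).indicator hA).add
      (memLp_finsetSum _ fun i _ => ((Lp.memLp (v i)).const_mul (c i)).indicator hA.compl)
  refine ⟨hW.toLp, ?_, fun i => ?_⟩
  · filter_upwards [hW.coeFn_toLp] with t ht htA
    rw [ht, Set.indicator_of_mem htA, add_eq_left]
    exact Finset.sum_eq_zero fun i _ => Set.indicator_of_notMem (by simpa using htA) _
  · have hd : ∀ᵐ t ∂μ, ∀ j, j ≠ i → v j t * conj (v i t) = 0 := by
      refine Filter.eventually_all.2 fun j => ?_
      by_cases hj : j = i
      · simp [hj]
      · filter_upwards [measure_eq_zero_iff_ae_notMem.1 (hdisj hj)] with t ht _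
        by_contra h0
        refine ht ⟨fun h => h0 (by rw [h, zero_mul]), fun h => h0 (by rw [h, map_zero, mul_zero])⟩
    have h1 : ∀ᵐ t ∂μ, (hW.toLp : Lp 𝕜 2 μ) t * conj (v i t) =
        A.indicator (fun t => g t * conj (v i t)) t +
          c i * Aᶜ.indicator (fun t => v i t * conj (v i t)) t := by
      filter_upwards [hd, hW.coeFn_toLp] with t h2 h3
      rw [h3]
      by_cases htA : t ∈ A
      · simp [htA]
      · have h4 : ∑ j, c j * (v j t * conj (v i t)) = c i * (v i t * conj (v i t)) :=
          Finset.sum_eq_single i (fun j _ hj => by rw [h2 j hj, mul_zero]) (by simp)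
        simp [htA, Finset.sum_mul, h4, mul_assoc]
    rw [integral_congr_ae h1, integral_add ((integrable_mul_conj g (v i)).indicator hA)
      (((integrable_mul_conj (v i) (v i)).indicator hA.compl).const_mul _), integral_const_mul,
      integral_indicator hA, integral_indicator hA.compl]
    change a i + (η i - a i) / b i * b i = η i
    rw [div_mul_cancel₀ _ (hb i), add_sub_cancel]

end Moments

/-! ### The main theorem. -/

theorem proposition4p8 {𝕜 : Type*} [RCLike 𝕜] (N : ℕ) (hN : 1 ≤ N) (m : ℕ) (hm : 3 ≤ m)
    (A B : Set (EuclideanSpace ℝ (Fin N)))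
    (hA : NullMeasurableSet A volume) (hB : NullMeasurableSet B volume)
    (hAfin : volume A < ⊤) (hBfin : volume B < ⊤)
    (v : Fin (m - 2) → Lp 𝕜 2 (volume : Measure (EuclideanSpace ℝ (Fin N))))
    (C : Fin (m - 2) → Set (EuclideanSpace ℝ (Fin N)))
    -- `C i` is the support `{t | v i t ≠ 0}` of `v i`, which is determined up to a null set
    (hsupp : ∀ i, C i =ᵐ[volume] Function.support (v i))
    (hdisj : Pairwise fun i j => AEDisjoint volume (C i) (C j))
    (hCfin : ∀ i, volume (C i) < ⊤)
    (hCA : ∀ i, 0 < volume (C i ∩ Aᶜ))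
    -- `vA` and `vB` are the functions with indices `m - 1` and `m`
    (vA vB : Lp 𝕜 2 (volume : Measure (EuclideanSpace ℝ (Fin N))))
    (η : Fin (m - 2) → 𝕜) :
    ∃ x : Lp 𝕜 2 (volume : Measure (EuclideanSpace ℝ (Fin N))),
      (∀ i, ∫ t in C i, x t * conj (v i t) = η i) ∧
      (∀ᵐ t ∂volume, t ∈ A → x t = vA t) ∧
      (∀ᵐ ξ ∂volume, ξ ∈ B → fourierL2 x ξ = fourierL2 vB ξ) := by
  set S : Fin (m - 2) → Set (EuclideanSpace ℝ (Fin N)) := fun i => Function.support (v i)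
  have hS : ∀ i, MeasurableSet (S i) := fun i =>
    (Lp.stronglyMeasurable (v i)).measurable (measurableSet_singleton 0).compl
  have hSfin : ∀ i, volume (S i) < ⊤ := fun i => by
    rw [← measure_congr (hsupp i)]
    exact hCfin i
  -- The measurable hull contains `A` and equals it almost everywhere, so the sets `C i \ A` keep
  -- their positive measure.
  set A₁ := toMeasurable volume A
  have hA₁ : MeasurableSet A₁ := measurableSet_toMeasurable _ _
  obtain ⟨w, hwA, hwη⟩ := exists_eq_on_and_integral_mul_conj_eq hA₁ v
    (fun i j hij => (hdisj hij).congr (hsupp i).symm (hsupp j).symm)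
    (fun i => by
      rw [measure_congr ((hsupp i).symm.inter hA.toMeasurable_ae_eq.compl)]
      exact hCA i) vA η
  have hU : MeasurableSet (A₁ ∪ ⋃ i, S i) := hA₁.union (.iUnion hS)
  have hUfin : volume (A₁ ∪ ⋃ i, S i) < ⊤ := by
    refine measure_union_lt_top (by rwa [measure_toMeasurable]) ?_
    refine (measure_iUnion_le _).trans_lt ?_
    rw [tsum_fintype]
    exact ENNReal.sum_lt_top.2 fun i _ => hSfin i
  obtain ⟨x, hx, hxB⟩ := exists_eq_on_and_fourierL2_eq_on hN hU hUfin.ne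
    (measurableSet_toMeasurable volume B) (by rw [measure_toMeasurable]; exact hBfin.ne) w vB
  refine ⟨x, fun i => ?_, ?_, ?_⟩
  · rw [setIntegral_congr_set (hsupp i), ← hwη i,
      setIntegral_eq_integral_of_forall_compl_eq_zero fun t ht => by
        rw [Function.notMem_support.1 ht, map_zero, mul_zero]]
    refine integral_congr_ae ?_
    filter_upwards [hx] with t ht
    by_cases h0 : v i t = 0
    · simp [h0]
    · rw [ht (Or.inr (Set.mem_iUnion.2 ⟨i, h0⟩))]
  · filter_upwards [hx, hwA] with t h1 h2 htA
    have h3 : t ∈ A₁ := subset_toMeasurable _ _ htA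
    rw [h1 (Or.inl h3), h2 h3]
  · filter_upwards [hxB] with ξ h1 hξ
    exact h1 (subset_toMeasurable _ _ hξ)
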